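/- Let $n>m>0$ be integers with $\gcd(n,m)=1$. A complex polynomial is called Schur stable if all its roots lie in the open unit disc. Let $$\Omega_n=\{[1:b:c]\in\mathbb P^2_{\mathbb C}:\ \zeta^n+b\zeta^m+c \text{ is Schur stable}\},\qquad \Pi_n:\Omega_n\to\mathbb P^2_{\mathbb R},\quad \Pi_n([1:b:c])=[1:|b|:(-1)^n|c|].$$ For real $u,v$ put $$\omega(u,v)=\frac{1}{2\pi}\left(n\arccos\frac{u^2+v^2-1}{2u|v|}+m\arccos\frac{1-u^2+v^2}{2|v|}\right),$$ and define the following subsets of $\mathbb R^2$ (where the condition $2\omega(u,v)>n-1$ is understood to fail if $\omega(u,v)$ is undefined): $$\Gamma_0=\{(u,v): 0\le u,\ 0\le v,\ u+v<1\},\qquad \Delta_0=\{(u,v): 0<u,\ 0<v,\ u+v\ge 1,\ 2\omega(u,v)>n-1\},$$ $$\Gamma_1=\{(u,v): 0\le u,\ v\le 0,\ u-v<1\},\qquad \Delta_1=\{(u,v): 0<u,\ v<0,\ u-v\ge 1,\ 2\omega(u,v)>n-1\}.$$ Each of them is also regarded as a subset of $\mathbb P^2_{\mathbb R}$ through $(u,v)\mapsto[1:u:v]$.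 (a) A point of $\mathbb P^2_{\mathbb C}$ belongs to $\Omega_n$ if and only if it can be written as $$[1: xe^{it}e^{-i(n-m)s}: ye^{-ins}]$$ with $[1:x:y]\in\Pi_n(\Omega_n)$, $x,y\in\mathbb R$, $0\le s\le 2\pi$, and a real number $t$ such that one of the following holds: 1. $[1:x:y]\in\Gamma_{n \bmod 2}$ and $|t|\le \pi/n$; 2. $[1:x:y]\in\Delta_{n \bmod 2}$ and $|t|<\pi\,(2\omega(x,y)-n+1)/n$. (b) Equivalently, for all $b,c\in\mathbb C$, the trinomial $\zeta^n+b\zeta^m+c$ is Schur stable if and only if it is equal to $$\zeta^n+xe^{it}e^{-i(n-m)s}\zeta^m+ye^{-ins}$$ for some real $x,y,s,t$ such that $\zeta^n+x\zeta^m+y$ is Schur stable, $0\le s\le 2\pi$, and either $(x,y)\in\Gamma_{n\bmod 2}$ and $|t|\le\pi/n$, or $(x,y)\in\Delta_{n\bmod 2}$ and $|t|<\pi\,(2\omega(x,y)-n+1)/n$. -/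

import Mathlib

open Polynomial
open scoped LinearAlgebra.Projectivization

noncomputable section

namespace SchurTrinomial

/-- A complex polynomial is Schur stable if all its roots lie in the open unit disc. -/
def SchurStable (f : ℂ[X]) : Prop := ∀ z : ℂ, f.IsRoot z → ‖z‖ < 1

/-- The trinomial `ζ^n + b ζ^m + c`. -/
def trinomial (n m : ℕ) (b c : ℂ) : ℂ[X] := X ^ n + C b * X ^ m + C c

/-- The point `[1 : u : v]` of the projective plane over `K`. -/
def pt {K : Type*} [Field K] (u v : K) : ℙ K (Fin 3 → K) :=
  Projectivization.mk K ![1, u, v] (fun h => one_ne_zero (congrFun h 0))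

/-- The stability region `Ω_n`, a subset of the complex projective plane. -/
def Omega (n m : ℕ) : Set (ℙ ℂ (Fin 3 → ℂ)) :=
  {p | ∃ b c : ℂ, p = pt b c ∧ SchurStable (trinomial n m b c)}

/-- The vector `(|a|, |b|, (-1)^n |c|)` attached to `(a, b, c)`. -/
def absVec (n : ℕ) (w : Fin 3 → ℂ) : Fin 3 → ℝ := ![‖w 0‖, ‖w 1‖, (-1) ^ n * ‖w 2‖]

theorem absVec_ne_zero (n : ℕ) {w : Fin 3 → ℂ} (hw : w ≠ 0) : absVec n w ≠ 0 := by
  intro h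
  apply hw
  have h0 := congrFun h 0
  have h1 := congrFun h 1
  have h2 := congrFun h 2
  simp [absVec] at h0 h1 h2
  funext i
  fin_cases i <;> simp [h0, h1, h2]

theorem absVec_smul (n : ℕ) (l : ℂ) (w : Fin 3 → ℂ) : absVec n (l • w) = ‖l‖ • absVec n w := by
  funext i
  fin_cases i <;> simp [absVec]
  ring

/-- The projection `Π_n`, `[a : b : c] ↦ [|a| : |b| : (-1)^n |c|]`, from the complex to the real
projective plane. On points `[1 : b : c]` it is `[1 : |b| : (-1)^n |c|]`, see `proj_pt`. -/
def proj (n : ℕ) : ℙ ℂ (Fin 3 → ℂ) → ℙ ℝ (Fin 3 → ℝ) :=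
  Projectivization.lift
    (fun w : {w : Fin 3 → ℂ // w ≠ 0} =>
      Projectivization.mk ℝ (absVec n w) (absVec_ne_zero n w.2))
    (by
      intro a b l h
      refine (Projectivization.mk_eq_mk_iff' ℝ _ _ _ _).2 ⟨‖l‖, ?_⟩
      rw [h, absVec_smul])

theorem proj_pt (n : ℕ) (b c : ℂ) : proj n (pt b c) = pt ‖b‖ ((-1) ^ n * ‖c‖) := by
  simp [proj, pt, absVec]

/-- The quantity `ω(u, v)`. -/
def omega (n m : ℕ) (u v : ℝ) : ℝ :=
  (n * Real.arccos ((u ^ 2 + v ^ 2 - 1) / (2 * u * |v|))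
    + m * Real.arccos ((1 - u ^ 2 + v ^ 2) / (2 * |v|))) / (2 * Real.pi)

/-- `Γ_0` as a subset of the plane. -/
def Gamma0 : Set (ℝ × ℝ) := {q | 0 ≤ q.1 ∧ 0 ≤ q.2 ∧ q.1 + q.2 < 1}

/-- `Γ_1` as a subset of the plane. -/
def Gamma1 : Set (ℝ × ℝ) := {q | 0 ≤ q.1 ∧ q.2 ≤ 0 ∧ q.1 - q.2 < 1}

/-- `Δ_0` as a subset of the plane. The inequality `2 ω > n - 1` fails wherever an argument of an
`arccos` in `ω` lies outside `[-1, 1]` (`0 < m < n` and `u + v ≥ 1`), so the conventional values of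
`Real.arccos` there are harmless. -/
def Delta0 (n m : ℕ) : Set (ℝ × ℝ) :=
  {q | 0 < q.1 ∧ 0 < q.2 ∧ 1 ≤ q.1 + q.2 ∧ (n : ℝ) - 1 < 2 * omega n m q.1 q.2}

/-- `Δ_1` as a subset of the plane. -/
def Delta1 (n m : ℕ) : Set (ℝ × ℝ) :=
  {q | 0 < q.1 ∧ q.2 < 0 ∧ 1 ≤ q.1 - q.2 ∧ (n : ℝ) - 1 < 2 * omega n m q.1 q.2}

/-- `Γ_{n mod 2}` as a subset of the plane. -/
def Gamma (n : ℕ) : Set (ℝ × ℝ) := if n % 2 = 0 then Gamma0 else Gamma1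

/-- `Δ_{n mod 2}` as a subset of the plane. -/
def Delta (n m : ℕ) : Set (ℝ × ℝ) := if n % 2 = 0 then Delta0 n m else Delta1 n m

/-- The set of points `[1 : u : v]` of the real projective plane with `(u, v) ∈ S`. -/
def toProj (S : Set (ℝ × ℝ)) : Set (ℙ ℝ (Fin 3 → ℝ)) := {p | ∃ q ∈ S, p = pt q.1 q.2}

/-- The coefficient `x e^{it} e^{-i(n-m)s}`. -/
def coeffB (n m : ℕ) (x s t : ℝ) : ℂ :=
  x * Complex.exp (Complex.I * t) * Complex.exp (-Complex.I * ((n : ℂ) - m) * s)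

/-- The coefficient `y e^{-ins}`. -/
def coeffC (n : ℕ) (y s : ℝ) : ℂ := y * Complex.exp (-Complex.I * n * s)

end SchurTrinomial

end

/-! Rotating `ζ` preserves stability, and since `gcd(n, m) = 1` it brings every trinomial to `ζ^n +
x e^{it} ζ^m + (-1)^n y` with `x, y ≥ 0` and `|t| ≤ π/n` (`exists_coeff_eq`). So the question is
which phases `t` are stable for given moduli.

If `e^{τ+iθ}` is a root, dividing by `e^{nτ}` makes the three terms close up to a triangle with
sides `1`, `u = x e^{-(n-m)τ}`, `v = y e^{-nτ}`. Its angles fix the directions of the terms up to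
reflection; eliminating `θ` gives `n t ≡ ±π(2ω(u,v) - n + 1)` modulo `2π` (`exists_phase_of_root`).
Conversely, by Bézout, equality of `n|t|` with this threshold produces a root
(`exists_root_of_phase`).

Now let `τ` grow from `0`. No root of modulus at least `1` exists when `x + y < 1`. Otherwise `u +
v` decreases to `1`, where `2ω = n` and the threshold is `π`. If `n|t|` is below the initial
threshold, monotonicity of `ω` (`omega_le_omega_scale`) excludes roots outside the open disc; if it
is at least the initial threshold, the intermediate value theorem gives such a root
(`lt_of_schurStable`). -/

namespace SchurTrinomial

/-! ### Triangles with sides `1`, `u`, `v` -/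

/-- The angle opposite to the unit side. -/
noncomputable def angleOne (u v : ℝ) : ℝ := Real.arccos ((u ^ 2 + v ^ 2 - 1) / (2 * u * v))

/-- The angle opposite to the side `u`. -/
noncomputable def angleU (u v : ℝ) : ℝ := Real.arccos ((1 - u ^ 2 + v ^ 2) / (2 * v))

theorem two_pi_mul_omega (n m : ℕ) (u : ℝ) {v : ℝ} (hv : 0 < v) :
    2 * Real.pi * omega n m u v = n * angleOne u v + m * angleU u v := by
  have := Real.pi_ne_zero
  rw [omega, angleOne, angleU, abs_of_pos hv]
  field_simp

theorem omega_neg_one_pow_mul (n m k : ℕ) (u v : ℝ) :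
    omega n m u ((-1) ^ k * v) = omega n m u v := by
  rcases neg_one_pow_eq_or ℝ k with h | h <;> simp [omega, h]

theorem angleOne_eq_zero {u v : ℝ} (hu : 0 < u) (hv : 0 < v) (h : 1 ≤ (u - v) ^ 2) :
    angleOne u v = 0 := by
  rw [angleOne, Real.arccos_eq_zero, le_div_iff₀ (by positivity)]
  nlinarith

theorem angleU_eq_zero {u v : ℝ} (hv : 0 < v) (h : u ^ 2 ≤ (1 - v) ^ 2) :
    angleU u v = 0 := by
  rw [angleU, Real.arccos_eq_zero, le_div_iff₀ (by positivity)]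
  nlinarith

/-- Where the triangle inequality fails, `Real.arccos` saturates at `0` or `π` and `ω` is constant.
These values let the arguments below pass through degenerate triangles. -/
theorem omega_eq_zero (n m : ℕ) {u v : ℝ} (hu : 0 < u) (hv : 0 < v) (h : 1 + u ≤ v) :
    omega n m u v = 0 := by
  have h1 := two_pi_mul_omega n m u hv
  rw [angleOne_eq_zero hu hv (by nlinarith), angleU_eq_zero hv (by nlinarith)] at h1
  simpa [Real.pi_ne_zero] using h1

theorem two_mul_omega_eq_of_one_add_le (n m : ℕ) {u v : ℝ} (hu : 0 < u) (hv : 0 < v)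
    (h : 1 + v ≤ u) : 2 * omega n m u v = m := by
  have h1 := two_pi_mul_omega n m u hv
  have h2 : angleU u v = Real.pi := by
    rw [angleU, Real.arccos_eq_pi, div_le_iff₀ (by positivity)]
    nlinarith
  rw [angleOne_eq_zero hu hv (by nlinarith), h2] at h1
  have := Real.pi_pos
  apply mul_left_cancel₀ this.ne'
  linarith

theorem two_mul_omega_eq_of_add_eq_one (n m : ℕ) {u v : ℝ} (hu : 0 < u) (hv : 0 < v)
    (h : u + v = 1) : 2 * omega n m u v = n := by
  have h1 := two_pi_mul_omega n m u hv
  have h2 : angleOne u v = Real.pi := by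
    rw [angleOne, Real.arccos_eq_pi, div_le_iff₀ (by positivity)]
    nlinarith
  rw [h2, angleU_eq_zero hv (by nlinarith)] at h1
  have := Real.pi_pos
  apply mul_left_cancel₀ this.ne'
  linarith

theorem cos_angleOne {u v : ℝ} (hu : 0 < u) (hv : 0 < v) (h1 : 1 ≤ u + v) (h2 : (u - v) ^ 2 ≤ 1) :
    Real.cos (angleOne u v) = (u ^ 2 + v ^ 2 - 1) / (2 * u * v) := by
  rw [angleOne, Real.cos_arccos]
  · rw [le_div_iff₀ (by positivity)]; nlinarith
  · rw [div_le_iff₀ (by positivity)]; nlinarith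

theorem cos_angleU {u v : ℝ} (hu : 0 < u) (hv : 0 < v) (h1 : 1 ≤ u + v) (h2 : (u - v) ^ 2 ≤ 1) :
    Real.cos (angleU u v) = (1 - u ^ 2 + v ^ 2) / (2 * v) := by
  have h3 : |u - v| ≤ 1 := by rwa [sq_le_one_iff_abs_le_one] at h2
  rw [abs_le] at h3
  rw [angleU, Real.cos_arccos]
  · rw [le_div_iff₀ (by positivity)]; nlinarith
  · rw [div_le_iff₀ (by positivity)]; nlinarith

theorem cos_angleU_add {u v : ℝ} (hu : 0 < u) (hv : 0 < v) (h1 : 1 ≤ u + v)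
    (h2 : (u - v) ^ 2 ≤ 1) : Real.cos (angleU u v) + u * Real.cos (angleOne u v) = v := by
  rw [cos_angleU hu hv h1 h2, cos_angleOne hu hv h1 h2]
  field_simp
  ring

theorem sin_angleU {u v : ℝ} (hu : 0 < u) (hv : 0 < v) (h1 : 1 ≤ u + v)
    (h2 : (u - v) ^ 2 ≤ 1) : Real.sin (angleU u v) = u * Real.sin (angleOne u v) := by
  have ha : 0 ≤ Real.sin (angleOne u v) :=
    Real.sin_nonneg_of_nonneg_of_le_pi (Real.arccos_nonneg _) (Real.arccos_le_pi _)
  have hb : 0 ≤ Real.sin (angleU u v) :=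
    Real.sin_nonneg_of_nonneg_of_le_pi (Real.arccos_nonneg _) (Real.arccos_le_pi _)
  rw [← sq_eq_sq₀ hb (by positivity), mul_pow, Real.sin_sq, Real.sin_sq, cos_angleU hu hv h1 h2,
    cos_angleOne hu hv h1 h2]
  field_simp
  ring

theorem two_mul_omega_le {n m : ℕ} (hmn : m ≤ n) {u v : ℝ} (hu : 0 < u) (hv : 0 < v)
    (h1 : 1 ≤ u + v) (h2 : (u - v) ^ 2 ≤ 1) : 2 * omega n m u v ≤ n := by
  have h3 : |u - v| ≤ 1 := by rwa [sq_le_one_iff_abs_le_one] at h2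
  rw [abs_le] at h3
  -- Two angles of a triangle sum to at most `π`; together with `m ≤ n` this gives `n α + m β ≤ n
  -- π`.
  have hle : angleOne u v ≤ Real.pi - angleU u v := by
    by_contra! hlt
    have hc : Real.cos (angleOne u v) < Real.cos (Real.pi - angleU u v) :=
      Real.cos_lt_cos_of_nonneg_of_le_pi (sub_nonneg.2 (Real.arccos_le_pi _))
      (Real.arccos_le_pi _) hlt
    rw [Real.cos_pi_sub, cos_angleU hu hv h1 h2, cos_angleOne hu hv h1 h2, ← sub_pos,
      show -((1 - u ^ 2 + v ^ 2) / (2 * v)) - (u ^ 2 + v ^ 2 - 1) / (2 * u * v) =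
        -((1 + u) * (v - (1 - u)) * (v + (1 - u))) / (2 * u * v) by field_simp; ring] at hc
    apply absurd hc
    rw [not_lt, neg_div, neg_nonpos]
    exact div_nonneg (mul_nonneg (mul_nonneg (by linarith) (by linarith)) (by linarith))
      (by positivity)
  have hb : 0 ≤ angleU u v := Real.arccos_nonneg _
  have h4 := two_pi_mul_omega n m u hv
  have h5 : (m : ℝ) ≤ n := by exact_mod_cast hmn
  apply le_of_mul_le_mul_left _ Real.pi_pos
  nlinarith [mul_le_mul_of_nonneg_right h5 hb,
    mul_le_mul_of_nonneg_left hle (Nat.cast_nonneg (α := ℝ) n)]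

/-- The directions of the sides of a triangle with sides `1`, `u`, `v`, one of them positive real,
are given by its angles. -/
theorem exists_angles {u v φ ψ : ℝ} (hu : 0 < u) (hv : 0 < v)
    (hc : Real.cos φ + u * Real.cos ψ = v) (hs : Real.sin φ + u * Real.sin ψ = 0) :
    1 ≤ u + v ∧ (u - v) ^ 2 ≤ 1 ∧ ∃ σ : ℤ, (σ = 1 ∨ σ = -1) ∧ ∃ k l : ℤ,
      φ = σ * angleU u v + 2 * Real.pi * l ∧ ψ = -σ * angleOne u v + 2 * Real.pi * k := by
  have e1 := Real.sin_sq_add_cos_sq φ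
  have e2 := Real.sin_sq_add_cos_sq ψ
  have hcφ : Real.cos φ = v - u * Real.cos ψ := by linarith
  have hsφ : Real.sin φ = -(u * Real.sin ψ) := by linarith
  have e3 : 1 = u ^ 2 + v ^ 2 - 2 * u * v * Real.cos ψ := by
    rw [hcφ, hsφ] at e1; linear_combination -e1 + u ^ 2 * e2
  have e4 := Real.cos_le_one ψ
  have e5 := Real.neg_one_le_cos ψ
  have e6 : 0 < u * v := by positivity
  have h1 : 1 ≤ u + v := by
    have : 1 ≤ (u + v) ^ 2 := by nlinarith
    nlinarith
  have h2 : (u - v) ^ 2 ≤ 1 := by nlinarith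
  refine ⟨h1, h2, ?_⟩
  have c1 : Real.cos (angleOne u v) = Real.cos ψ := by
    rw [cos_angleOne hu hv h1 h2, div_eq_iff (by positivity)]; linarith
  have c2 : Real.cos (angleU u v) = Real.cos φ := by
    have := cos_angleU_add hu hv h1 h2
    rw [c1] at this; linarith
  have s2 := sin_angleU hu hv h1 h2
  obtain ⟨l, hl⟩ := Real.cos_eq_cos_iff.1 c2
  obtain ⟨k, hk⟩ := Real.cos_eq_cos_iff.1 c1
  -- The cosines fix each angle only up to its own sign. The sine equation forces the signs to
  -- match, except for a flat triangle, where the sign of `angleOne` (`0` or `π`) is immaterial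
  -- modulo `2π`.
  have key : ∀ σ σ' : ℤ, (σ = 1 ∨ σ = -1) → (σ' = 1 ∨ σ' = -1) →
      φ = σ * angleU u v + 2 * Real.pi * l → ψ = -σ' * angleOne u v + 2 * Real.pi * k →
      ∃ σ : ℤ, (σ = 1 ∨ σ = -1) ∧ ∃ k l : ℤ,
      φ = σ * angleU u v + 2 * Real.pi * l ∧ ψ = -σ * angleOne u v + 2 * Real.pi * k := by
    intro σ σ' hσ hσ' hφ hψ
    by_cases he : σ = σ'
    · subst he
      exact ⟨σ, hσ, k, l, hφ, hψ⟩
    · have sφ : Real.sin φ = σ * Real.sin (angleU u v) := by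
        rw [hφ, show σ * angleU u v + 2 * Real.pi * l = σ * angleU u v + l * (2 * Real.pi) by ring,
          Real.sin_add_int_mul_two_pi]
        rcases hσ with rfl | rfl <;> simp
      have sψ : Real.sin ψ = -σ' * Real.sin (angleOne u v) := by
        rw [hψ, show -σ' * angleOne u v + 2 * Real.pi * k
          = -σ' * angleOne u v + k * (2 * Real.pi) by ring, Real.sin_add_int_mul_two_pi]
        rcases hσ' with rfl | rfl <;> simp
      have s0 : Real.sin (angleOne u v) = 0 := by
        rw [sφ, sψ, s2] at hs
        have : u * Real.sin (angleOne u v) = 0 := by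
          rcases hσ with rfl | rfl <;> rcases hσ' with rfl | rfl
          · simp at he
          · push_cast at hs; linarith
          · push_cast at hs; linarith
          · simp at he
        simpa [hu.ne'] using this
      have hz : angleOne u v = 0 ∨ angleOne u v = Real.pi := by
        by_contra! hcon
        have := Real.sin_pos_of_pos_of_lt_pi
          ((Real.arccos_nonneg _).lt_of_ne hcon.1.symm) ((Real.arccos_le_pi _).lt_of_ne hcon.2)
        exact this.ne' s0
      have hσσ : σ' = -σ := by omega
      rcases hz with hz | hz
      · exact ⟨σ, hσ, k, l, hφ, by rw [hψ, hz]; ring⟩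
      · refine ⟨σ, hσ, k + σ, l, hφ, ?_⟩
        rw [hψ, hz, hσσ]; push_cast; ring
  rcases hl with hl | hl <;> rcases hk with hk | hk
  · exact key 1 (-1) (by simp) (by simp) (by rw [hl]; push_cast; ring) (by rw [hk]; push_cast; ring)
  · exact key 1 1 (by simp) (by simp) (by rw [hl]; push_cast; ring) (by rw [hk]; push_cast; ring)
  · exact key (-1) (-1) (by simp) (by simp) (by rw [hl]; push_cast; ring)
      (by rw [hk]; push_cast; ring)
  · exact key (-1) 1 (by simp) (by simp) (by rw [hl]; push_cast; ring)
      (by rw [hk]; push_cast; ring)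

/-! ### Monotonicity of `ω` under radial scaling -/

/-- The coefficient modulus `x` after rescaling the variable by `e ^ τ`. -/
noncomputable def scaleU (n m : ℕ) (x τ : ℝ) : ℝ := x * Real.exp (-(((n : ℝ) - m) * τ))

/-- The modulus `y` of the constant coefficient after rescaling the variable by `e ^ τ`. -/
noncomputable def scaleV (n : ℕ) (y τ : ℝ) : ℝ := y * Real.exp (-(n * τ))

theorem scaleU_pos (n m : ℕ) {x : ℝ} (hx : 0 < x) (τ : ℝ) : 0 < scaleU n m x τ := by
  unfold scaleU; positivity

theorem scaleV_pos (n : ℕ) {y : ℝ} (hy : 0 < y) (τ : ℝ) : 0 < scaleV n y τ := by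
  unfold scaleV; positivity

@[simp] theorem scaleU_zero (n m : ℕ) (x : ℝ) : scaleU n m x 0 = x := by simp [scaleU]

@[simp] theorem scaleV_zero (n : ℕ) (y : ℝ) : scaleV n y 0 = y := by simp [scaleV]

theorem hasDerivAt_scaleU (n m : ℕ) (x τ : ℝ) :
    HasDerivAt (scaleU n m x) (-((n : ℝ) - m) * scaleU n m x τ) τ := by
  have h : HasDerivAt (fun σ : ℝ => -(((n : ℝ) - m) * σ)) (-((n : ℝ) - m)) τ :=
    (hasDerivAt_const_mul _).neg
  have h' : HasDerivAt (fun σ : ℝ => x * Real.exp (-(((n : ℝ) - m) * σ))) _ τ :=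
    h.exp.const_mul x
  exact h'.congr_deriv (by rw [scaleU]; ring)

theorem hasDerivAt_scaleV (n : ℕ) (y τ : ℝ) :
    HasDerivAt (scaleV n y) (-(n : ℝ) * scaleV n y τ) τ := by
  have h : HasDerivAt (fun σ : ℝ => -((n : ℝ) * σ)) (-(n : ℝ)) τ :=
    (hasDerivAt_const_mul _).neg
  have h' : HasDerivAt (fun σ : ℝ => y * Real.exp (-((n : ℝ) * σ))) _ τ := h.exp.const_mul y
  exact h'.congr_deriv (by rw [scaleV]; ring)

theorem continuous_scaleU (n m : ℕ) (x : ℝ) : Continuous (scaleU n m x) := by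
  unfold scaleU; fun_prop

theorem continuous_scaleV (n : ℕ) (y : ℝ) : Continuous (scaleV n y) := by
  unfold scaleV; fun_prop

/-- No triangle inequality is needed, because `Real.arccos` is continuous on all of `ℝ`. -/
theorem continuous_omega_scale (n m : ℕ) {x y : ℝ} (hx : 0 < x) (hy : 0 < y) :
    Continuous fun τ => omega n m (scaleU n m x τ) (scaleV n y τ) := by
  have hu := continuous_scaleU n m x
  have hv := continuous_scaleV n y
  have hu0 := scaleU_pos n m hx
  have hv0 := scaleV_pos n hy
  unfold omega
  refine ((continuous_const.mul (Real.continuous_arccos.comp ?_)).add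
    (continuous_const.mul (Real.continuous_arccos.comp ?_))).div_const _
  · refine ((hu.pow 2).add (hv.pow 2) |>.sub continuous_const).div
      ((continuous_const.mul hu).mul hv.abs) fun τ => ?_
    have := hu0 τ; have := hv0 τ; positivity
  · refine ((continuous_const.sub (hu.pow 2)).add (hv.pow 2)).div
      (continuous_const.mul hv.abs) fun τ => ?_
    have := hv0 τ; positivity

theorem deriv_weighted_angles_nonneg (n m : ℕ) {x y τ : ℝ} (hx : 0 < x) (hy : 0 < y)
    (h1 : 1 < scaleU n m x τ + scaleV n y τ) (h2 : (scaleU n m x τ - scaleV n y τ) ^ 2 < 1) :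
    ∃ d, 0 ≤ d ∧ HasDerivAt (fun σ => n * angleOne (scaleU n m x σ) (scaleV n y σ)
      + m * angleU (scaleU n m x σ) (scaleV n y σ)) d τ := by
  have hU := hasDerivAt_scaleU n m x τ
  have hV := hasDerivAt_scaleV n y τ
  have hu0 := scaleU_pos n m hx τ
  have hv0 := scaleV_pos n hy τ
  set u := scaleU n m x τ with hu
  set v := scaleV n y τ with hv
  have h3 : |u - v| < 1 := by rwa [sq_lt_one_iff_abs_lt_one] at h2
  rw [abs_lt] at h3
  set A := (u ^ 2 + v ^ 2 - 1) / (2 * u * v) with hA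
  set B := (1 - u ^ 2 + v ^ 2) / (2 * v) with hB
  have hA1 : A < 1 := by rw [hA, div_lt_iff₀ (by positivity)]; nlinarith
  have hA2 : -1 < A := by rw [hA, lt_div_iff₀ (by positivity)]; nlinarith
  have hB1 : B < 1 := by rw [hB, div_lt_iff₀ (by positivity)]; nlinarith
  have hB2 : -1 < B := by rw [hB, lt_div_iff₀ (by positivity)]; nlinarith
  -- The law of sines: it leaves a single square root in the derivative.
  have hBA : √(1 - B ^ 2) = u * √(1 - A ^ 2) := by
    rw [show 1 - B ^ 2 = u ^ 2 * (1 - A ^ 2) by rw [hA, hB]; field_simp; ring,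
      Real.sqrt_mul (by positivity), Real.sqrt_sq hu0.le]
  have hpos : 0 < √(1 - A ^ 2) := Real.sqrt_pos.2 (by nlinarith)
  have hdA : HasDerivAt
      (fun σ => (scaleU n m x σ ^ 2 + scaleV n y σ ^ 2 - 1) / (2 * scaleU n m x σ * scaleV n y σ))
      _ τ := (((hU.fun_pow 2).fun_add (hV.fun_pow 2)).sub_const 1).fun_div
        ((hU.const_mul 2).fun_mul hV) (by rw [← hu, ← hv]; positivity)
  have hdB : HasDerivAt
      (fun σ => (1 - scaleU n m x σ ^ 2 + scaleV n y σ ^ 2) / (2 * scaleV n y σ))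
      _ τ := (((hU.fun_pow 2).const_sub 1).fun_add (hV.fun_pow 2)).fun_div
        (hV.const_mul 2) (by rw [← hv]; positivity)
  have hd1 := (Real.hasDerivAt_arccos hA2.ne' hA1.ne).comp τ hdA
  have hd2 := (Real.hasDerivAt_arccos hB2.ne' hB1.ne).comp τ hdB
  refine ⟨_, ?_, (hd1.const_mul (n : ℝ)).add (hd2.const_mul (m : ℝ))⟩
  rw [hBA]
  simp only [← hu, ← hv]
  -- The numerator is `2((n - m u)² + n m (v² - (1 - u)²))`, nonnegative by the triangle inequality.
  have hnum : 0 ≤ 2 * ((n : ℝ) ^ 2 + m ^ 2 * u ^ 2 - n * m * (1 + u ^ 2 - v ^ 2)) := by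
    have : (0 : ℝ) ≤ n * m * (v ^ 2 - (1 - u) ^ 2) :=
      mul_nonneg (by positivity) (by nlinarith)
    nlinarith [sq_nonneg ((n : ℝ) - m * u)]
  have hfin := div_nonneg hnum (show 0 ≤ 2 * u * v * √(1 - A ^ 2) by positivity)
  refine hfin.trans_eq ?_
  field_simp
  ring

theorem omega_scale_le_of_forall_mem_Ioo (n m : ℕ) {x y a b : ℝ} (hx : 0 < x) (hy : 0 < y)
    (hab : a ≤ b)
    (h1 : ∀ τ ∈ Set.Ioo a b, 1 < scaleU n m x τ + scaleV n y τ)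
    (h2 : ∀ τ ∈ Set.Ioo a b, (scaleU n m x τ - scaleV n y τ) ^ 2 < 1) :
    omega n m (scaleU n m x a) (scaleV n y a) ≤ omega n m (scaleU n m x b) (scaleV n y b) := by
  have hfun : (fun σ => n * angleOne (scaleU n m x σ) (scaleV n y σ)
      + m * angleU (scaleU n m x σ) (scaleV n y σ)) =
      fun σ => 2 * Real.pi * omega n m (scaleU n m x σ) (scaleV n y σ) :=
    funext fun σ => (two_pi_mul_omega n m _ (scaleV_pos n hy σ)).symm
  have hmono : MonotoneOn (fun σ => 2 * Real.pi * omega n m (scaleU n m x σ) (scaleV n y σ))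
      (Set.Icc a b) := by
    -- `Real.arccos` is not differentiable at `±1`, so flat triangles at the endpoints are reached
    -- by continuity only.
    refine monotoneOn_of_deriv_nonneg (convex_Icc a b)
      (continuous_const.mul (continuous_omega_scale n m hx hy)).continuousOn ?_ ?_
    · intro τ hτ
      rw [interior_Icc] at hτ
      obtain ⟨d, -, hd⟩ := deriv_weighted_angles_nonneg n m hx hy (h1 τ hτ) (h2 τ hτ)
      rw [hfun] at hd
      exact hd.differentiableAt.differentiableWithinAt
    · intro τ hτ
      rw [interior_Icc] at hτ
      obtain ⟨d, hd0, hd⟩ := deriv_weighted_angles_nonneg n m hx hy (h1 τ hτ) (h2 τ hτ)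
      rw [hfun] at hd
      rwa [hd.deriv]
  have := hmono (Set.left_mem_Icc.2 hab) (Set.right_mem_Icc.2 hab) hab
  exact le_of_mul_le_mul_left this (by have := Real.pi_pos; positivity)

theorem scale_add_lt {n m : ℕ} (hmn : m < n) {x y a b : ℝ} (hx : 0 < x) (hy : 0 < y)
    (hab : a < b) : scaleU n m x b + scaleV n y b < scaleU n m x a + scaleV n y a := by
  have h : (m : ℝ) < n := by exact_mod_cast hmn
  have h0 : (0 : ℝ) ≤ m := m.cast_nonneg
  have hs : 0 < ((n : ℝ) - m) * (b - a) := mul_pos (by linarith) (by linarith)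
  have ht : 0 < (n : ℝ) * (b - a) := mul_pos (by linarith) (by linarith)
  unfold scaleU scaleV
  gcongr ?_ + ?_
  · exact mul_lt_mul_of_pos_left (Real.exp_lt_exp.2 (by linarith)) hx
  · exact mul_lt_mul_of_pos_left (Real.exp_lt_exp.2 (by linarith)) hy

theorem scaleV_lt_one_add_scaleU {n m : ℕ} (hmn : m < n) {x y τ : ℝ} (hx : 0 < x) (hτ : 0 < τ)
    (h : y ≤ 1 + x) : scaleV n y τ < 1 + scaleU n m x τ := by
  have hmn' : (m : ℝ) < n := by exact_mod_cast hmn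
  have h0 : (0 : ℝ) ≤ m := m.cast_nonneg
  have h1 : Real.exp (-(n * τ)) < 1 := by
    rw [Real.exp_lt_one_iff]; nlinarith
  have h2 : Real.exp (-(n * τ)) ≤ Real.exp (-(((n : ℝ) - m) * τ)) :=
    Real.exp_le_exp.2 (by nlinarith)
  have h3 := mul_le_mul_of_nonneg_left h2 hx.le
  have h4 := mul_le_mul_of_nonneg_right h (Real.exp_pos (-(n * τ))).le
  unfold scaleU scaleV
  linarith

/-- If `2 ω > m`, then `ω` does not decrease when the variable is rescaled outwards, as long as
the rescaled coefficients satisfy `u + v ≥ 1`. -/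
theorem omega_le_omega_scale {n m : ℕ} (hmn : m < n) {x y τ : ℝ} (hx : 0 < x) (hy : 0 < y)
    (hτ : 0 ≤ τ) (hω : (m : ℝ) < 2 * omega n m x y)
    (h1 : 1 ≤ scaleU n m x τ + scaleV n y τ) :
    omega n m x y ≤ omega n m (scaleU n m x τ) (scaleV n y τ) := by
  have hyx : y ≤ 1 + x := by
    by_contra! h
    rw [omega_eq_zero n m hx hy h.le] at hω
    have := m.cast_nonneg (α := ℝ)
    linarith
  have main : ∀ b, 0 ≤ b → b ≤ τ →
      (∀ σ ∈ Set.Ioo 0 b, scaleU n m x σ < 1 + scaleV n y σ) →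
      omega n m x y ≤ omega n m (scaleU n m x b) (scaleV n y b) := by
    intro b hb0 hbτ hb
    have := omega_scale_le_of_forall_mem_Ioo n m hx hy hb0
      (fun σ hσ => lt_of_le_of_lt h1 (scale_add_lt hmn hx hy (hσ.2.trans_le hbτ)))
      (fun σ hσ => by
        rw [sq_lt_one_iff_abs_lt_one, abs_lt]
        have := hb σ hσ
        have := scaleV_lt_one_add_scaleU hmn hx hσ.1 hyx
        constructor <;> linarith)
    simpa using this
  by_cases hS : ∃ σ ∈ Set.Icc 0 τ, 1 + scaleV n y σ ≤ scaleU n m x σ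
  -- At the first `b` with `u ≥ 1 + v` one has `2ω = m`, yet monotonicity up to `b` keeps `2ω` at
  -- least its initial value, which exceeds `m`.
  · exfalso
    have hcomp : IsCompact {σ ∈ Set.Icc 0 τ | 1 + scaleV n y σ ≤ scaleU n m x σ} :=
      isCompact_Icc.inter_right
        (isClosed_le (continuous_const.add (continuous_scaleV n y)) (continuous_scaleU n m x))
    obtain ⟨b, ⟨⟨hb0, hbτ⟩, hb⟩, hmin⟩ := hcomp.exists_isLeast hS
    have := main b hb0 hbτ fun σ hσ => by
      by_contra! hcon
      exact absurd (hmin ⟨⟨hσ.1.le, hσ.2.le.trans hbτ⟩, hcon⟩) (not_le.2 hσ.2)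
    have h3 := two_mul_omega_eq_of_one_add_le n m (scaleU_pos n m hx b) (scaleV_pos n hy b) hb
    linarith
  · push Not at hS
    exact main τ hτ le_rfl fun σ hσ => hS σ ⟨hσ.1.le, hσ.2.le⟩

/-! ### Roots of trinomials -/

theorem schurStable_trinomial_iff {n m : ℕ} {b c : ℂ} :
    SchurStable (trinomial n m b c) ↔ ∀ z : ℂ, z ^ n + b * z ^ m + c = 0 → ‖z‖ < 1 := by
  simp [SchurStable, trinomial, IsRoot]

theorem schurStable_of_norm_add_norm_lt_one {n m : ℕ} (hmn : m ≤ n) {b c : ℂ}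
    (h : ‖b‖ + ‖c‖ < 1) : SchurStable (trinomial n m b c) := by
  rw [schurStable_trinomial_iff]
  intro z hz
  by_contra! h1
  have h2 : z ^ n = -(b * z ^ m + c) := by linear_combination hz
  have h3 : ‖z‖ ^ n ≤ ‖b‖ * ‖z‖ ^ m + ‖c‖ := by
    rw [← norm_pow, h2, norm_neg]
    refine (norm_add_le _ _).trans ?_
    rw [norm_mul, norm_pow]
  have h4 : ‖z‖ ^ m ≤ ‖z‖ ^ n := pow_le_pow_right₀ h1 hmn
  have h5 : 1 ≤ ‖z‖ ^ n := one_le_pow₀ h1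
  nlinarith [norm_nonneg b, norm_nonneg c, mul_le_mul_of_nonneg_left h4 (norm_nonneg b),
    mul_le_mul_of_nonneg_left h5 (norm_nonneg c)]

theorem SchurStable.rotate {n m : ℕ} (hmn : m ≤ n) {b c w : ℂ} (hw : ‖w‖ = 1)
    (h : SchurStable (trinomial n m b c)) :
    SchurStable (trinomial n m (b * w ^ (n - m)) (c * w ^ n)) := by
  rw [schurStable_trinomial_iff] at h ⊢
  intro z hz
  have hw0 : w ≠ 0 := by rintro rfl; simp at hw
  have := h (z / w) (by
    have h1 : w ^ n = w ^ (n - m) * w ^ m := by rw [← pow_add, Nat.sub_add_cancel hmn]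
    have : w ^ n * ((z / w) ^ n + b * (z / w) ^ m + c) = 0 := by
      rw [← hz, div_pow, div_pow, mul_add, mul_add, mul_div_cancel₀ _ (pow_ne_zero n hw0)]
      nth_rw 1 [h1]
      field_simp
    simpa [hw0] using this)
  simpa [hw] using this

/-- As `n` and `m` are not both even, the leftover multiples of `π` in the phase equation are
multiples of `2π`. -/
theorem even_crossing {n m : ℕ} (hgcd : Nat.gcd n m = 1) {σ : ℤ} (hσ : σ = 1 ∨ σ = -1) :
    Even (σ * ((n : ℤ) - 1) - (n - m) * (n + 1)) := by
  have h : ¬ (Even n ∧ Even m) := by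
    rintro ⟨hn, hm⟩
    have := Nat.dvd_gcd hn.two_dvd hm.two_dvd
    omega
  rcases hσ with rfl | rfl <;> by_cases hn : Even n <;> by_cases hm : Even m <;>
    simp_all [parity_simps]

/-- A trinomial vanishes at `e ^ (τ + iθ)` iff the three terms close up to a triangle with sides
`1`, `scaleU n m x τ`, `scaleV n y τ`. -/
theorem eval_exp_eq_zero_iff (n m : ℕ) (x y t τ θ : ℝ) :
    Complex.exp (τ + θ * Complex.I) ^ n
      + x * Complex.exp (Complex.I * t) * Complex.exp (τ + θ * Complex.I) ^ m
      + ((((-1) ^ n * y : ℝ)) : ℂ) = 0 ↔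
    Real.cos (n * θ - (n + 1) * Real.pi)
        + scaleU n m x τ * Real.cos (t + m * θ - (n + 1) * Real.pi) = scaleV n y τ ∧
      Real.sin (n * θ - (n + 1) * Real.pi)
        + scaleU n m x τ * Real.sin (t + m * θ - (n + 1) * Real.pi) = 0 := by
  -- Factoring out `e^{i(n+1)π} e^{nτ}` turns the constant term into `-v`; this is the origin of the
  -- shift by `(n + 1)π`.
  have hπ : Complex.exp (((n : ℂ) + 1) * Real.pi * Complex.I) = -(-1) ^ n := by
    rw [show ((n : ℂ) + 1) * Real.pi * Complex.I
      = n * (Real.pi * Complex.I) + Real.pi * Complex.I by ring, Complex.exp_add,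
      Complex.exp_nat_mul, Complex.exp_pi_mul_I]
    ring
  set φ : ℝ := n * θ - (n + 1) * Real.pi with hφ
  set ψ : ℝ := t + m * θ - (n + 1) * Real.pi with hψ
  have key : Complex.exp (τ + θ * Complex.I) ^ n
      + x * Complex.exp (Complex.I * t) * Complex.exp (τ + θ * Complex.I) ^ m
      + ((((-1) ^ n * y : ℝ)) : ℂ) =
      -(-1) ^ n * Complex.exp (n * τ) * (Complex.exp (φ * Complex.I)
        + scaleU n m x τ * Complex.exp (ψ * Complex.I) - scaleV n y τ) := by
    rw [← hπ, mul_sub, mul_add]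
    have e1 : Complex.exp (τ + θ * Complex.I) ^ n =
        Complex.exp (((n : ℂ) + 1) * Real.pi * Complex.I) * Complex.exp (n * τ)
          * Complex.exp (φ * Complex.I) := by
      rw [← Complex.exp_nat_mul, ← Complex.exp_add, ← Complex.exp_add, hφ]
      congr 1; push_cast; ring
    have e2 : x * Complex.exp (Complex.I * t) * Complex.exp (τ + θ * Complex.I) ^ m =
        Complex.exp (((n : ℂ) + 1) * Real.pi * Complex.I) * Complex.exp (n * τ)
          * (scaleU n m x τ * Complex.exp (ψ * Complex.I)) := by
      have h : Complex.exp (Complex.I * t) * Complex.exp (m * (τ + θ * Complex.I)) =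
          Complex.exp (((n : ℂ) + 1) * Real.pi * Complex.I) * Complex.exp (n * τ)
            * (Complex.exp ((-(((n : ℝ) - m) * τ) : ℝ)) * Complex.exp (ψ * Complex.I)) := by
        simp only [← Complex.exp_add, hψ]
        congr 1; push_cast; ring
      rw [scaleU, Complex.ofReal_mul, Complex.ofReal_exp, ← Complex.exp_nat_mul]
      linear_combination (x : ℂ) * h
    have e3 : ((((-1) ^ n * y : ℝ)) : ℂ) =
        -(Complex.exp (((n : ℂ) + 1) * Real.pi * Complex.I) * Complex.exp (n * τ)
          * scaleV n y τ) := by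
      have h : Complex.exp (n * τ) * Complex.exp ((-(n * τ) : ℝ)) = 1 := by
        rw [← Complex.exp_add]; push_cast; rw [add_neg_cancel, Complex.exp_zero]
      rw [hπ, scaleV, Complex.ofReal_mul y, Complex.ofReal_exp]
      push_cast at h ⊢
      linear_combination -(-1 : ℂ) ^ n * y * h
    rw [e1, e2, e3]; ring
  rw [key, mul_eq_zero, or_iff_right (by simp), Complex.ext_iff]
  simp only [Complex.sub_re, Complex.add_re, Complex.exp_ofReal_mul_I_re, Complex.re_ofReal_mul,
    Complex.ofReal_re, Complex.zero_re, Complex.sub_im, Complex.add_im,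
    Complex.exp_ofReal_mul_I_im, Complex.im_ofReal_mul, Complex.ofReal_im, Complex.zero_im,
    sub_zero, sub_eq_zero]

/-- The phase `t` for which a trinomial has a root of modulus `e ^ τ` is determined by `ω` up to
sign and multiples of `2π / n`. -/
theorem exists_phase_of_root {n m : ℕ} (hgcd : Nat.gcd n m = 1) {x y t τ θ : ℝ} (hx : 0 < x)
    (hy : 0 < y)
    (h : Complex.exp (τ + θ * Complex.I) ^ n
      + x * Complex.exp (Complex.I * t) * Complex.exp (τ + θ * Complex.I) ^ m
      + ((((-1) ^ n * y : ℝ)) : ℂ) = 0) :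
    1 ≤ scaleU n m x τ + scaleV n y τ ∧ (scaleU n m x τ - scaleV n y τ) ^ 2 ≤ 1 ∧
    ∃ σ : ℤ, (σ = 1 ∨ σ = -1) ∧ ∃ j : ℤ,
      n * t = σ * (Real.pi * (2 * omega n m (scaleU n m x τ) (scaleV n y τ) - n + 1))
        + 2 * Real.pi * j := by
  rw [eval_exp_eq_zero_iff] at h
  have hv := scaleV_pos n hy τ
  obtain ⟨h1, h2, σ, hσ, k, l, hφ, hψ⟩ := exists_angles (scaleU_pos n m hx τ) hv h.1 h.2
  refine ⟨h1, h2, -σ, by omega, ?_⟩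
  obtain ⟨j, hj⟩ := even_crossing hgcd (σ := -σ) (by omega)
  refine ⟨n * k - m * l - j + (-σ) * (n - 1), ?_⟩
  have hω := two_pi_mul_omega n m (scaleU n m x τ) hv
  have hj' : -(σ : ℝ) * (n - 1) - (n - m) * (n + 1) = j + j := by exact_mod_cast hj
  push_cast
  -- `θ` cancels in `n ψ - m φ`, leaving `n t - (n - m)(n + 1)π`.
  linear_combination (n : ℝ) * hψ - m * hφ + σ * hω - Real.pi * hj'

theorem exists_root_of_phase {n m : ℕ} (hn : 0 < n) (hgcd : Nat.gcd n m = 1) {x y t τ : ℝ}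
    (hx : 0 < x) (hy : 0 < y) (h1 : 1 ≤ scaleU n m x τ + scaleV n y τ)
    (h2 : (scaleU n m x τ - scaleV n y τ) ^ 2 ≤ 1)
    (ht : n * |t| = Real.pi * (2 * omega n m (scaleU n m x τ) (scaleV n y τ) - n + 1)) :
    ∃ θ : ℝ, Complex.exp (τ + θ * Complex.I) ^ n
      + x * Complex.exp (Complex.I * t) * Complex.exp (τ + θ * Complex.I) ^ m
      + ((((-1) ^ n * y : ℝ)) : ℂ) = 0 := by
  have hu := scaleU_pos n m hx τ
  have hv := scaleV_pos n hy τ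
  obtain ⟨σ, hσ, hσt⟩ : ∃ σ : ℤ, (σ = 1 ∨ σ = -1) ∧ (n : ℝ) * t = -σ * (n * |t|) := by
    rcases abs_choice t with h | h
    · exact ⟨-1, by simp, by rw [h]; push_cast; ring⟩
    · exact ⟨1, by simp, by rw [h]; push_cast; ring⟩
  rw [ht] at hσt
  obtain ⟨j, hj⟩ := even_crossing hgcd hσ
  have hω := two_pi_mul_omega n m (scaleU n m x τ) hv
  set α := angleOne (scaleU n m x τ) (scaleV n y τ) with hα
  set β := angleU (scaleU n m x τ) (scaleV n y τ) with hβ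
  have hbez : (n : ℤ) * n.gcdA m + m * n.gcdB m = 1 := by
    rw [← Nat.gcd_eq_gcd_ab, hgcd]; rfl
  -- With `θ` chosen so that `φ = σβ + 2πk`, the equation for `ψ` becomes `n l = j + m k`, which
  -- Bézout solves.
  set k : ℤ := -j * n.gcdB m with hk
  set l : ℤ := j * n.gcdA m with hl
  have hkl : (n : ℝ) * l = j + m * k := by
    have : (n : ℤ) * l = j + m * k := by rw [hk, hl]; linear_combination j * hbez
    exact_mod_cast this
  have hj' : (σ : ℝ) * (n - 1) - (n - m) * (n + 1) = j + j := by exact_mod_cast hj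
  have hn0 : (n : ℝ) ≠ 0 := by exact_mod_cast hn.ne'
  refine ⟨((n + 1) * Real.pi + σ * β + 2 * Real.pi * k) / n, ?_⟩
  rw [eval_exp_eq_zero_iff]
  set θ := ((n + 1) * Real.pi + σ * β + 2 * Real.pi * k) / n with hθ
  have hnθ : n * θ = (n + 1) * Real.pi + σ * β + 2 * Real.pi * k := by
    rw [hθ, mul_div_cancel₀ _ hn0]
  have hφ : n * θ - (n + 1) * Real.pi = σ * β + k * (2 * Real.pi) := by
    rw [hnθ]; ring
  have hψ : t + m * θ - (n + 1) * Real.pi = -σ * α + l * (2 * Real.pi) := by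
    apply mul_left_cancel₀ hn0
    linear_combination hσt + m * hnθ - σ * hω + Real.pi * hj' - 2 * Real.pi * hkl
  rw [hφ, hψ, Real.cos_add_int_mul_two_pi, Real.sin_add_int_mul_two_pi,
    Real.cos_add_int_mul_two_pi, Real.sin_add_int_mul_two_pi]
  have hc := cos_angleU_add hu hv h1 h2
  have hs := sin_angleU hu hv h1 h2
  rw [← hα, ← hβ] at hc hs
  rcases hσ with rfl | rfl <;> simp <;> constructor <;> linarith

/-! ### Stability as a bound on the phase -/

theorem schurStable_of_abs_lt {n m : ℕ} (hmn : m < n) (hgcd : Nat.gcd n m = 1)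
    {x y t : ℝ} (hx : 0 < x) (hy : 0 < y) (hω : (n : ℝ) - 1 < 2 * omega n m x y)
    (ht : |t| < Real.pi * (2 * omega n m x y - n + 1) / n) :
    SchurStable (trinomial n m (x * Complex.exp (Complex.I * t))
      (((-1) ^ n * y : ℝ) : ℂ)) := by
  rw [schurStable_trinomial_iff]
  intro z hz
  by_contra! h1
  have hz0 : z ≠ 0 := by rintro rfl; simp at h1; linarith
  have hn : (0 : ℝ) < n := by exact_mod_cast (Nat.zero_le m).trans_lt hmn
  set τ := Real.log ‖z‖ with hτ
  set θ := Complex.arg z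
  have hzexp : Complex.exp (τ + θ * Complex.I) = z := by
    rw [Complex.exp_add, hτ, ← Complex.ofReal_exp, Real.exp_log (norm_pos_iff.2 hz0),
      Complex.norm_mul_exp_arg_mul_I]
  rw [← hzexp] at hz
  obtain ⟨h2, h3, σ, hσ, j, hj⟩ := exists_phase_of_root hgcd hx hy hz
  have hmn' : (m : ℝ) ≤ n - 1 := by
    have : m + 1 ≤ n := hmn
    rw [le_sub_iff_add_le]; exact_mod_cast this
  have h4 := omega_le_omega_scale hmn hx hy (Real.log_nonneg h1) (hmn'.trans_lt hω) h2
  have h5 := two_mul_omega_le hmn.le (scaleU_pos n m hx τ) (scaleV_pos n hy τ) h2 h3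
  have hπ := Real.pi_pos
  set q := Real.pi * (2 * omega n m (scaleU n m x τ) (scaleV n y τ) - n + 1) with hq
  have hq1 : q ≤ Real.pi := by rw [hq]; nlinarith
  rw [lt_div_iff₀ hn] at ht
  have hq2 : |t| * n < q := ht.trans_le (by rw [hq]; gcongr)
  have habs : |n * t| < q := by rwa [abs_mul, abs_of_pos hn, mul_comm]
  rw [abs_lt] at habs
  have hσq : |(σ : ℝ) * q| = q := by
    have : 0 ≤ q := by linarith
    rcases hσ with rfl | rfl <;> simp [this]
  have hσq' := abs_le.1 hσq.le
  -- Since `n|t| < q ≤ π`, a nonzero `j` would push `±q + 2πj` out of `(-q, q)`; with `j = 0`, `n|t|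
  -- = q`, a contradiction.
  have hj0 : j = 0 := by
    have h6 : (j : ℝ) < 1 := by by_contra! h; nlinarith
    have h7 : (-1 : ℝ) < j := by by_contra! h; nlinarith
    have h8 : j < 1 := by exact_mod_cast h6
    have h9 : -1 < j := by exact_mod_cast h7
    omega
  rw [hj0] at hj
  rcases hσ with rfl | rfl <;> push_cast at hj <;> linarith

theorem exists_scale_add_eq_one {n m : ℕ} (hmn : m < n) {x y : ℝ} (hx : 0 < x) (hy : 0 < y)
    (h : 1 ≤ x + y) : ∃ τ, 0 ≤ τ ∧ scaleU n m x τ + scaleV n y τ = 1 := by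
  have hmn' : (m : ℝ) + 1 ≤ n := by exact_mod_cast hmn
  have hm0 : (0 : ℝ) ≤ m := m.cast_nonneg
  have hL : 0 ≤ Real.log (x + y) := Real.log_nonneg h
  -- Both exponents `n - m` and `n` are at least `1`, so scaling by `e^τ = x + y` shrinks the sum at
  -- least by that factor.
  have hle : scaleU n m x (Real.log (x + y)) + scaleV n y (Real.log (x + y)) ≤ 1 := by
    have h0 : Real.exp (-Real.log (x + y)) = (x + y)⁻¹ := by
      rw [Real.exp_neg, Real.exp_log (by positivity)]
    calc _ ≤ x * Real.exp (-Real.log (x + y)) + y * Real.exp (-Real.log (x + y)) := by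
          unfold scaleU scaleV
          gcongr <;> nlinarith
      _ = 1 := by rw [h0]; field_simp
  obtain ⟨τ, hτ, he⟩ := intermediate_value_Icc' hL
    ((continuous_scaleU n m x).add (continuous_scaleV n y)).continuousOn
    (show (1 : ℝ) ∈ Set.Icc _ _ from ⟨hle, by simpa using h⟩)
  exact ⟨τ, hτ.1, he⟩

theorem lt_of_schurStable {n m : ℕ} (hm : 0 < m) (hmn : m < n) (hgcd : Nat.gcd n m = 1)
    {x y t : ℝ} (hx : 0 < x) (hy : 0 < y) (hxy : 1 ≤ x + y) (ht : |t| ≤ Real.pi / n)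
    (hs : SchurStable (trinomial n m (x * Complex.exp (Complex.I * t))
      (((-1) ^ n * y : ℝ) : ℂ))) :
    |t| < Real.pi * (2 * omega n m x y - n + 1) / n := by
  by_contra! hcon
  have hn : (0 : ℝ) < n := by exact_mod_cast hm.trans hmn
  have hn2 : (2 : ℝ) ≤ n := by
    have : 2 ≤ n := by omega
    exact_mod_cast this
  have hπ := Real.pi_pos
  rw [div_le_iff₀ hn] at hcon
  rw [le_div_iff₀ hn] at ht
  have hu0 := scaleU_pos n m hx
  have hv0 := scaleV_pos n hy
  obtain ⟨T, hT0, hT⟩ := exists_scale_add_eq_one hmn hx hy hxy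
  have hωT := two_mul_omega_eq_of_add_eq_one n m (hu0 T) (hv0 T) hT
  obtain ⟨τ, ⟨hτ0, hτT⟩, hτ⟩ := intermediate_value_Icc hT0
    (f := fun τ => Real.pi * (2 * omega n m (scaleU n m x τ) (scaleV n y τ) - n + 1))
    (by
      exact (continuous_const.mul (((continuous_const.mul
        (continuous_omega_scale n m hx hy)).sub continuous_const).add
        continuous_const)).continuousOn)
    (show |t| * n ∈ Set.Icc _ _ from ⟨by simpa using hcon, by
      simp only [hωT]; linarith⟩)
  simp only at hτ
  have hadd : ∀ σ ≤ T, 1 ≤ scaleU n m x σ + scaleV n y σ := by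
    intro σ hσ
    rcases hσ.eq_or_lt with rfl | h
    · exact hT.ge
    · exact hT.symm.le.trans (scale_add_lt hmn hx hy h).le
  have hno : ∀ σ, 0 ≤ σ → σ ≤ T → (scaleU n m x σ - scaleV n y σ) ^ 2 ≤ 1 →
      |t| * n ≠ Real.pi * (2 * omega n m (scaleU n m x σ) (scaleV n y σ) - n + 1) := by
    intro σ h0 h1 h2 h3
    rw [mul_comm] at h3
    obtain ⟨θ, hθ⟩ := exists_root_of_phase (hm.trans hmn) hgcd hx hy (hadd σ h1) h2 h3
    have := schurStable_trinomial_iff.1 hs _ hθ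
    rw [Complex.norm_exp] at this
    simp at this
    linarith
  -- Otherwise `ω = 0` and the threshold `π(1 - n)` is negative, as `n ≥ 2`.
  have hv : scaleV n y τ < 1 + scaleU n m x τ := by
    by_contra! h
    rw [omega_eq_zero n m (hu0 τ) (hv0 τ) h] at hτ
    nlinarith [abs_nonneg t, mul_nonneg (abs_nonneg t) hn.le]
  rcases le_total (scaleU n m x τ) (1 + scaleV n y τ) with hu | hu
  · exact hno τ hτ0 hτT (by rw [sq_le_one_iff_abs_le_one, abs_le]; constructor <;> linarith) hτ.symm
  -- If no triangle exists at `τ` because `u ≥ 1 + v`, move out to `r` with `u = 1 + v`: the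
  -- triangle there is flat and still has `2ω = m`, so it yields the root.
  · obtain ⟨r, ⟨hr0, hrT⟩, hr⟩ := intermediate_value_Icc hτT
      (f := fun τ => 1 + scaleV n y τ - scaleU n m x τ)
      ((continuous_const.add (continuous_scaleV n y)).sub (continuous_scaleU n m x)).continuousOn
      (show (0 : ℝ) ∈ Set.Icc _ _ from ⟨by linarith, by
        have := hv0 T
        linarith⟩)
    simp only at hr
    refine hno r (hτ0.trans hr0) hrT (by
      rw [sq_le_one_iff_abs_le_one, abs_le]; constructor <;> linarith) ?_
    rw [← hτ, two_mul_omega_eq_of_one_add_le n m (hu0 r) (hv0 r) (by linarith),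
      two_mul_omega_eq_of_one_add_le n m (hu0 τ) (hv0 τ) hu]

theorem norm_lt_one_of_schurStable_of_left_eq_zero {n m : ℕ} (hn : 0 < n) {c : ℂ}
    (h : SchurStable (trinomial n m 0 c)) : ‖c‖ < 1 := by
  obtain ⟨z, hz⟩ := IsAlgClosed.exists_pow_nat_eq (-c) hn
  have h1 := schurStable_trinomial_iff.1 h z (by rw [hz]; ring)
  rw [← norm_neg, ← hz, norm_pow]
  exact pow_lt_one₀ (norm_nonneg _) h1 hn.ne'

theorem norm_lt_one_of_schurStable_of_right_eq_zero {n m : ℕ} (hmn : m < n) {b : ℂ}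
    (h : SchurStable (trinomial n m b 0)) : ‖b‖ < 1 := by
  obtain ⟨z, hz⟩ := IsAlgClosed.exists_pow_nat_eq (-b) (Nat.sub_pos_of_lt hmn)
  have h1 := schurStable_trinomial_iff.1 h z (by
    rw [← Nat.sub_add_cancel hmn.le, pow_add, hz]; ring)
  rw [← norm_neg, ← hz, norm_pow]
  exact pow_lt_one₀ (norm_nonneg _) h1 (Nat.sub_pos_of_lt hmn).ne'

/-! ### The stability regions -/

theorem neg_one_pow_mul_neg_one_pow_mul (n : ℕ) (y : ℝ) : (-1) ^ n * ((-1) ^ n * y) = y := by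
  rw [← mul_assoc, ← mul_pow]; simp

theorem mem_Gamma_iff {n : ℕ} {x y : ℝ} :
    (x, y) ∈ Gamma n ↔ 0 ≤ x ∧ 0 ≤ (-1) ^ n * y ∧ x + (-1) ^ n * y < 1 := by
  by_cases h : n % 2 = 0
  · simp [Gamma, Gamma0, h, (Nat.even_iff.2 h).neg_one_pow]
  · simp [Gamma, Gamma1, h, (Nat.odd_iff.2 (by omega : n % 2 = 1)).neg_one_pow, sub_eq_add_neg]

theorem mem_Delta_iff {n m : ℕ} {x y : ℝ} :
    (x, y) ∈ Delta n m ↔ 0 < x ∧ 0 < (-1) ^ n * y ∧ 1 ≤ x + (-1) ^ n * y ∧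
      (n : ℝ) - 1 < 2 * omega n m x y := by
  by_cases h : n % 2 = 0
  · simp [Delta, Delta0, h, (Nat.even_iff.2 h).neg_one_pow]
  · simp [Delta, Delta1, h, (Nat.odd_iff.2 (by omega : n % 2 = 1)).neg_one_pow, sub_eq_add_neg]

theorem schurStable_of_mem {n m : ℕ} (hmn : m < n) (hgcd : Nat.gcd n m = 1) {x y t : ℝ}
    (h : (x, y) ∈ Gamma n ∨
      ((x, y) ∈ Delta n m ∧ |t| < Real.pi * (2 * omega n m x y - n + 1) / n)) :
    SchurStable (trinomial n m (x * Complex.exp (Complex.I * t)) y) := by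
  rcases h with h | ⟨h, ht⟩
  · rw [mem_Gamma_iff] at h
    apply schurStable_of_norm_add_norm_lt_one hmn.le
    have h1 : |y| = (-1) ^ n * y := by
      rw [← abs_of_nonneg h.2.1, abs_mul, abs_neg_one_pow, one_mul]
    rw [norm_mul, Complex.norm_exp_I_mul_ofReal, mul_one, Complex.norm_real, Complex.norm_real,
      Real.norm_eq_abs, Real.norm_eq_abs, abs_of_nonneg h.1, h1]
    exact h.2.2
  · rw [mem_Delta_iff] at h
    rw [← omega_neg_one_pow_mul n m n x y] at h ht
    have := schurStable_of_abs_lt hmn hgcd h.1 h.2.1 h.2.2.2 ht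
    rwa [neg_one_pow_mul_neg_one_pow_mul] at this

theorem mem_of_schurStable {n m : ℕ} (hm : 0 < m) (hmn : m < n) (hgcd : Nat.gcd n m = 1)
    {x y t : ℝ} (hx : 0 ≤ x) (hy : 0 ≤ (-1) ^ n * y) (ht : |t| ≤ Real.pi / n)
    (h : SchurStable (trinomial n m (x * Complex.exp (Complex.I * t)) y)) :
    (x, y) ∈ Gamma n ∨
      ((x, y) ∈ Delta n m ∧ |t| < Real.pi * (2 * omega n m x y - n + 1) / n) := by
  have hn : (0 : ℝ) < n := by exact_mod_cast hm.trans hmn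
  by_cases hxy : x + (-1) ^ n * y < 1
  · exact Or.inl (mem_Gamma_iff.2 ⟨hx, hy, hxy⟩)
  right
  push Not at hxy
  have hyn : |y| = (-1) ^ n * y := by
    rw [← abs_of_nonneg hy, abs_mul, abs_neg_one_pow, one_mul]
  have hx0 : 0 < x := by
    refine hx.lt_of_ne' ?_
    rintro rfl
    rw [Complex.ofReal_zero, zero_mul] at h
    have := norm_lt_one_of_schurStable_of_left_eq_zero (hm.trans hmn) h
    rw [Complex.norm_real, Real.norm_eq_abs] at this
    linarith
  have hy0 : 0 < (-1) ^ n * y := by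
    refine hy.lt_of_ne' fun h0 => ?_
    have hyz : y = 0 := by simpa using h0
    subst hyz
    rw [Complex.ofReal_zero] at h
    have := norm_lt_one_of_schurStable_of_right_eq_zero hmn h
    rw [norm_mul, Complex.norm_exp_I_mul_ofReal, mul_one, Complex.norm_real, Real.norm_eq_abs,
      abs_of_nonneg hx] at this
    linarith
  rw [← neg_one_pow_mul_neg_one_pow_mul n y] at h
  have key := lt_of_schurStable hm hmn hgcd hx0 hy0 hxy ht h
  rw [omega_neg_one_pow_mul] at key
  refine ⟨mem_Delta_iff.2 ⟨hx0, hy0, hxy, ?_⟩, key⟩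
  -- The bound on `|t|` is positive, which is the condition `2ω > n - 1`.
  have h0 := (abs_nonneg t).trans_lt key
  rw [lt_div_iff₀ hn, zero_mul] at h0
  have := pos_of_mul_pos_right h0 Real.pi_pos.le
  linarith

/-! ### Normal form of a trinomial up to rotation -/

theorem coeffB_eq {n m : ℕ} (hmn : m ≤ n) (x s t : ℝ) :
    coeffB n m x s t = x * Complex.exp (Complex.I * t) * Complex.exp (-Complex.I * s) ^ (n - m) := by
  rw [coeffB, ← Complex.exp_nat_mul, Nat.cast_sub hmn]
  congr 2; ring

theorem coeffC_eq (n : ℕ) (y s : ℝ) :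
    coeffC n y s = y * Complex.exp (-Complex.I * s) ^ n := by
  rw [coeffC, ← Complex.exp_nat_mul]
  congr 2; ring

theorem norm_exp_neg_I_mul_ofReal (s : ℝ) : ‖Complex.exp (-Complex.I * s)‖ = 1 := by
  rw [Complex.norm_exp]; simp

theorem schurStable_coeff_iff {n m : ℕ} (hmn : m ≤ n) (x y s t : ℝ) :
    SchurStable (trinomial n m (coeffB n m x s t) (coeffC n y s)) ↔
      SchurStable (trinomial n m (x * Complex.exp (Complex.I * t)) y) := by
  rw [coeffB_eq hmn, coeffC_eq]
  refine ⟨fun h => ?_, fun h => h.rotate hmn (norm_exp_neg_I_mul_ofReal s)⟩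
  have hw : Complex.exp (-Complex.I * s) ≠ 0 := Complex.exp_ne_zero _
  have := h.rotate hmn (w := (Complex.exp (-Complex.I * s))⁻¹)
    (by rw [norm_inv, norm_exp_neg_I_mul_ofReal, inv_one])
  rwa [mul_assoc, mul_assoc, mul_assoc, ← mul_pow, ← mul_pow, mul_inv_cancel₀ hw, one_pow, one_pow,
    mul_one, mul_one] at this

/-- The constant term fixes `s` only modulo `2π/n`. As `gcd(n, m) = 1`, these choices of `s` shift
`t` by every multiple of `2π/n`, so rounding achieves `|t| ≤ π/n`. -/
theorem exists_coeff_eq {n m : ℕ} (hmn : m < n) (hgcd : Nat.gcd n m = 1) (b c : ℂ) :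
    ∃ s t : ℝ, 0 ≤ s ∧ s ≤ 2 * Real.pi ∧ |t| ≤ Real.pi / n ∧
      coeffB n m ‖b‖ s t = b ∧ coeffC n ((-1) ^ n * ‖c‖) s = c := by
  have hπ := Real.pi_pos
  have hn : (0 : ℝ) < n := by exact_mod_cast (Nat.zero_le m).trans_lt hmn
  have hnC : (n : ℂ) ≠ 0 := by exact_mod_cast hn.ne'
  have hbez : (n : ℤ) * n.gcdA m + m * n.gcdB m = 1 := by
    rw [← Nat.gcd_eq_gcd_ab, hgcd]; rfl
  have hbez' : (n : ℂ) * (n.gcdA m : ℤ) + m * (n.gcdB m : ℤ) = 1 := by exact_mod_cast hbez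
  set δ := Complex.arg b
  set γ := Complex.arg c
  set t₀ : ℝ := δ + (n - m) * (Real.pi - γ / n) with ht₀
  set j : ℤ := -round (t₀ * n / (2 * Real.pi)) with hj
  set k : ℤ := j * n.gcdB m with hk
  set l : ℤ := j * n.gcdA m + k with hl
  set s₀ : ℝ := Real.pi - (γ + 2 * Real.pi * k) / n with hs₀
  set t : ℝ := t₀ + 2 * Real.pi * j / n with ht
  have hb : coeffB n m ‖b‖ s₀ t = b := by
    rw [coeffB, mul_assoc, ← Complex.exp_add]
    have : Complex.I * t + -Complex.I * ((n : ℂ) - m) * s₀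
        = δ * Complex.I + l * (2 * Real.pi * Complex.I) := by
      rw [ht, hs₀, ht₀, hl, hk]
      push_cast
      field_simp
      linear_combination (-2 * Real.pi * j : ℂ) * hbez'
    rw [this, Complex.exp_add, Complex.exp_int_mul_two_pi_mul_I, mul_one,
      Complex.norm_mul_exp_arg_mul_I]
  have hc : coeffC n ((-1) ^ n * ‖c‖) s₀ = c := by
    have h1 : -Complex.I * n * s₀
        = n * (-(Real.pi * Complex.I)) + (γ * Complex.I + k * (2 * Real.pi * Complex.I)) := by
      rw [hs₀]
      push_cast
      field_simp
      ring
    rw [coeffC, h1, Complex.exp_add, Complex.exp_add, Complex.exp_int_mul_two_pi_mul_I,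
      Complex.exp_nat_mul, Complex.exp_neg, Complex.exp_pi_mul_I, mul_one]
    push_cast
    rw [show ((-1 : ℂ))⁻¹ = -1 by norm_num, mul_mul_mul_comm, ← mul_pow,
      Complex.norm_mul_exp_arg_mul_I]
    simp
  have htle : |t| ≤ Real.pi / n := by
    have h1 := abs_sub_round (t₀ * n / (2 * Real.pi))
    have h2 : t = 2 * Real.pi / n * (t₀ * n / (2 * Real.pi) - round (t₀ * n / (2 * Real.pi))) := by
      rw [ht, hj]; push_cast; field_simp; ring
    rw [h2, abs_mul, abs_of_pos (by positivity)]
    calc _ ≤ 2 * Real.pi / n * (1 / 2) := by gcongr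
      _ = _ := by ring
  -- Both coefficients depend on `s` only through `e^{-is}`, so `s₀` may be reduced modulo `2π`.
  obtain ⟨s, hs, hexp⟩ : ∃ s ∈ Set.Ico (0 : ℝ) (0 + 2 * Real.pi),
      Complex.exp (-Complex.I * s) = Complex.exp (-Complex.I * s₀) := by
    refine ⟨toIcoMod Real.two_pi_pos 0 s₀, toIcoMod_mem_Ico Real.two_pi_pos 0 s₀, ?_⟩
    rw [Complex.exp_eq_exp_iff_exists_int]
    refine ⟨toIcoDiv Real.two_pi_pos 0 s₀, ?_⟩
    rw [toIcoMod]
    push_cast [zsmul_eq_mul]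
    ring
  refine ⟨s, t, hs.1, by linarith [hs.2], htle, ?_, ?_⟩
  · rw [coeffB_eq hmn.le, hexp, ← coeffB_eq hmn.le, hb]
  · rw [coeffC_eq, hexp, ← coeffC_eq, hc]

/-! ### Points `[1 : u : v]` and the final normal form -/

theorem pt_inj {K : Type*} [Field K] {u v u' v' : K} : pt u v = pt u' v' ↔ u = u' ∧ v = v' := by
  refine ⟨fun h => ?_, fun ⟨h1, h2⟩ => by rw [h1, h2]⟩
  obtain ⟨a, ha⟩ := (Projectivization.mk_eq_mk_iff' K _ _ _ _).1 h
  have h0 := congrFun ha 0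
  have h1 := congrFun ha 1
  have h2 := congrFun ha 2
  simp at h0 h1 h2
  subst h0
  simp_all

theorem pt_mem_toProj_iff {S : Set (ℝ × ℝ)} {x y : ℝ} : pt x y ∈ toProj S ↔ (x, y) ∈ S := by
  constructor
  · rintro ⟨⟨u, v⟩, hq, h⟩
    obtain ⟨rfl, rfl⟩ := pt_inj.1 h
    exact hq
  · exact fun h => ⟨(x, y), h, rfl⟩

theorem pt_mem_Omega_iff {n m : ℕ} {b c : ℂ} :
    pt b c ∈ Omega n m ↔ SchurStable (trinomial n m b c) := by
  constructor
  · rintro ⟨b', c', h, hs⟩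
    obtain ⟨rfl, rfl⟩ := pt_inj.1 h
    exact hs
  · exact fun h => ⟨b, c, rfl, h⟩

/-- The admissible phases are symmetric intervals, so `0` is admissible whenever some `t` is. -/
theorem schurStable_of_mem_zero_phase {n m : ℕ} (hmn : m < n) (hgcd : Nat.gcd n m = 1)
    {x y t : ℝ} (h : (x, y) ∈ Gamma n ∨
      ((x, y) ∈ Delta n m ∧ |t| < Real.pi * (2 * omega n m x y - n + 1) / n)) :
    SchurStable (trinomial n m (x : ℂ) (y : ℂ)) := by
  simpa using schurStable_of_mem hmn hgcd (t := 0)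
    (h.imp_right (And.imp_right fun ht => by simpa using (abs_nonneg t).trans_lt ht))

/-- A stable trinomial has a normal form whose parameters lie in the described region. -/
theorem exists_coeff_eq_of_schurStable {n m : ℕ} (hm : 0 < m) (hmn : m < n)
    (hgcd : Nat.gcd n m = 1) {b c : ℂ} (h : SchurStable (trinomial n m b c)) :
    ∃ s t : ℝ, 0 ≤ s ∧ s ≤ 2 * Real.pi ∧ |t| ≤ Real.pi / n ∧
      coeffB n m ‖b‖ s t = b ∧ coeffC n ((-1) ^ n * ‖c‖) s = c ∧
      ((‖b‖, (-1) ^ n * ‖c‖) ∈ Gamma n ∨ ((‖b‖, (-1) ^ n * ‖c‖) ∈ Delta n m ∧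
        |t| < Real.pi * (2 * omega n m ‖b‖ ((-1) ^ n * ‖c‖) - n + 1) / n)) := by
  obtain ⟨s, t, hs0, hs1, ht, hb, hc⟩ := exists_coeff_eq hmn hgcd b c
  refine ⟨s, t, hs0, hs1, ht, hb, hc, mem_of_schurStable hm hmn hgcd (norm_nonneg b) ?_ ht ?_⟩
  · rw [neg_one_pow_mul_neg_one_pow_mul]; exact norm_nonneg c
  · rwa [← schurStable_coeff_iff hmn.le, hb, hc]

end SchurTrinomial

theorem theorem1p2 (n m : ℕ) (hm : 0 < m) (hmn : m < n) (hgcd : Nat.gcd n m = 1) :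
    (∀ p : ℙ ℂ (Fin 3 → ℂ), p ∈ SchurTrinomial.Omega n m ↔
      ∃ x y s t : ℝ,
        p = SchurTrinomial.pt (SchurTrinomial.coeffB n m x s t) (SchurTrinomial.coeffC n y s) ∧
        SchurTrinomial.pt x y ∈ SchurTrinomial.proj n '' SchurTrinomial.Omega n m ∧
        0 ≤ s ∧ s ≤ 2 * Real.pi ∧
        ((SchurTrinomial.pt x y ∈ SchurTrinomial.toProj (SchurTrinomial.Gamma n) ∧
            |t| ≤ Real.pi / n) ∨
          (SchurTrinomial.pt x y ∈ SchurTrinomial.toProj (SchurTrinomial.Delta n m) ∧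
            |t| < Real.pi * (2 * SchurTrinomial.omega n m x y - n + 1) / n))) ∧
    (∀ b c : ℂ, SchurTrinomial.SchurStable (SchurTrinomial.trinomial n m b c) ↔
      ∃ x y s t : ℝ,
        SchurTrinomial.trinomial n m b c =
          SchurTrinomial.trinomial n m
            (SchurTrinomial.coeffB n m x s t) (SchurTrinomial.coeffC n y s) ∧
        SchurTrinomial.SchurStable (SchurTrinomial.trinomial n m (x : ℂ) (y : ℂ)) ∧
        0 ≤ s ∧ s ≤ 2 * Real.pi ∧
        (((x, y) ∈ SchurTrinomial.Gamma n ∧ |t| ≤ Real.pi / n) ∨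
          ((x, y) ∈ SchurTrinomial.Delta n m ∧
            |t| < Real.pi * (2 * SchurTrinomial.omega n m x y - n + 1) / n))) := by
  constructor
  · intro p
    constructor
    · rintro ⟨b, c, rfl, h⟩
      obtain ⟨s, t, hs0, hs1, ht, hb, hc, hmem⟩ :=
        SchurTrinomial.exists_coeff_eq_of_schurStable hm hmn hgcd h
      refine ⟨‖b‖, (-1) ^ n * ‖c‖, s, t, by rw [hb, hc],
        ⟨SchurTrinomial.pt b c, ⟨b, c, rfl, h⟩, SchurTrinomial.proj_pt n b c⟩, hs0, hs1, ?_⟩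
      simp only [SchurTrinomial.pt_mem_toProj_iff]
      exact hmem.imp_left fun h => ⟨h, ht⟩
    · rintro ⟨x, y, s, t, rfl, -, -, -, hmem⟩
      simp only [SchurTrinomial.pt_mem_toProj_iff] at hmem
      rw [SchurTrinomial.pt_mem_Omega_iff, SchurTrinomial.schurStable_coeff_iff hmn.le]
      exact SchurTrinomial.schurStable_of_mem hmn hgcd (hmem.imp_left And.left)
  · intro b c
    constructor
    · intro h
      obtain ⟨s, t, hs0, hs1, ht, hb, hc, hmem⟩ :=
        SchurTrinomial.exists_coeff_eq_of_schurStable hm hmn hgcd h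
      exact ⟨‖b‖, (-1) ^ n * ‖c‖, s, t, by rw [hb, hc],
        SchurTrinomial.schurStable_of_mem_zero_phase hmn hgcd hmem, hs0, hs1,
        hmem.imp_left fun h => ⟨h, ht⟩⟩
    · rintro ⟨x, y, s, t, he, -, -, -, hmem⟩
      rw [he, SchurTrinomial.schurStable_coeff_iff hmn.le]
      exact SchurTrinomial.schurStable_of_mem hmn hgcd (hmem.imp_left And.left)
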